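/- Let $F$ be a field of characteristic $2$, let $V$ be a finite-dimensional $F$-vector space and let $q:V\to F$ be a quadratic form whose polar form $\mathfrak b_q(u,v)=q(u+v)-q(u)-q(v)$ is nondegenerate. Let $\tau$ be an isometry of $(V,q)$ with $\tau^2=\mathrm{id}$, and put $$k(\tau)=\{x\in V\mid \tau(x)=x\},\qquad r(\tau)=\{\tau(x)-x\mid x\in V\},\qquad s=\dim_F r(\tau).$$ The Wall form of $\tau$ is the bilinear form $\omega_\tau$ on $r(\tau)$ given by $\omega_\tau(\tau(x)-x,\tau(y)-y)=\mathfrak b_q(\tau(x)-x,y)$ for $x,y\in V$. Let $J_\tau$ be the $F$-linear involution (anti-automorphism of square $\mathrm{id}$) of the Clifford algebra $C(q)$ with $J_\tau(v)=\tau(v)$ for all $v\in V$. Let $W$ be a complement of $r(\tau)$ in $k(\tau)$, i.e. $k(\tau)=W\oplus r(\tau)$, and suppose that $\omega_\tau$ is alternating, i.e. $\omega_\tau(u,u)=0$ for every $u\in r(\tau)$. Let $J_{\mathrm{id}}$ be the $F$-linear involution of $C(q|_W)$ that fixes every vector of $W$, and let $t$ be the transpose on $M_{2^s}(F)$. Then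 there is an isomorphism of $F$-algebras with involution $$(C(q),J_\tau)\;\simeq\;(C(q|_W),J_{\mathrm{id}})\otimes_F(M_{2^s}(F),t),$$ i.e. an isomorphism of $F$-algebras $C(q)\to C(q|_W)\otimes_F M_{2^s}(F)$ that carries $J_\tau$ to $J_{\mathrm{id}}\otimes t$. -/

import Mathlib

open scoped TensorProduct

/-! ### Algebras with involution (of the first kind) -/

/-- An `F`-linear involution on an `F`-algebra `A`: an `F`-linear anti-automorphism `σ`
with `σ ∘ σ = id`. -/
structure AlgInvolution (F A : Type*) [Field F] [Ring A] [Algebra F A] extends A →ₗ[F] A where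
  map_mul' : ∀ a b : A, toFun (a * b) = toFun b * toFun a
  involutive' : ∀ a : A, toFun (toFun a) = a

namespace AlgInvolution

variable {F A B : Type*} [Field F] [Ring A] [Algebra F A] [Ring B] [Algebra F B]

instance : CoeFun (AlgInvolution F A) (fun _ => A → A) := ⟨fun σ => σ.toLinearMap⟩

/-- Isomorphism of algebras with involution: `(A, σ) ≃ (B, σ')` if there is an isomorphism of
`F`-algebras `e : A ≃ B` with `e ∘ σ = σ' ∘ e`. -/
def Isomorphic (σ : AlgInvolution F A) (σ' : AlgInvolution F B) : Prop :=
  ∃ e : A ≃ₐ[F] B, ∀ a : A, e (σ a) = σ' (e a)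

/-- The involution `σ ⊗ σ'` on `A ⊗ B`, with `(σ ⊗ σ') (a ⊗ b) = σ a ⊗ σ' b`. -/
def tensor (σ : AlgInvolution F A) (σ' : AlgInvolution F B) : AlgInvolution F (A ⊗[F] B) where
  toLinearMap := TensorProduct.map σ.toLinearMap σ'.toLinearMap
  map_mul' x y := by
    change TensorProduct.map σ.toLinearMap σ'.toLinearMap (x * y) =
      TensorProduct.map σ.toLinearMap σ'.toLinearMap y *
        TensorProduct.map σ.toLinearMap σ'.toLinearMap x
    induction x using TensorProduct.induction_on with
    | zero => simp
    | add x₁ x₂ h₁ h₂ => simp [add_mul, mul_add, h₁, h₂]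
    | tmul a b =>
      induction y using TensorProduct.induction_on with
      | zero => simp
      | add y₁ y₂ h₁ h₂ => simp [add_mul, mul_add, h₁, h₂]
      | tmul c d =>
        have h₁ : σ.toLinearMap (a * c) = σ.toLinearMap c * σ.toLinearMap a := σ.map_mul' a c
        have h₂ : σ'.toLinearMap (b * d) = σ'.toLinearMap d * σ'.toLinearMap b := σ'.map_mul' b d
        simp [h₁, h₂]
  involutive' x := by
    change TensorProduct.map σ.toLinearMap σ'.toLinearMap
      (TensorProduct.map σ.toLinearMap σ'.toLinearMap x) = x
    induction x using TensorProduct.induction_on with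
    | zero => simp
    | add x₁ x₂ h₁ h₂ => simp [h₁, h₂]
    | tmul a b =>
      have h₁ : σ.toLinearMap (σ.toLinearMap a) = a := σ.involutive' a
      have h₂ : σ'.toLinearMap (σ'.toLinearMap b) = b := σ'.involutive' b
      simp [h₁, h₂]

/-- The transpose involution on the matrix algebra `M_n(F)`. -/
def transpose (F : Type*) [Field F] (n : ℕ) : AlgInvolution F (Matrix (Fin n) (Fin n) F) where
  toFun M := M.transpose
  map_add' M N := Matrix.transpose_add M N
  map_smul' c M := Matrix.transpose_smul c M
  map_mul' M N := Matrix.transpose_mul M N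
  involutive' M := Matrix.transpose_transpose M

end AlgInvolution

/-! ### Isometries of quadratic spaces -/

namespace QuadIsometry

variable {F V : Type*} [Field F] [AddCommGroup V] [Module F V] {q : QuadraticForm F V}

/-- The linear map `τ - id`. -/
def subId (τ : q.IsometryEquiv q) : V →ₗ[F] V :=
  (τ.toLinearEquiv : V →ₗ[F] V) - LinearMap.id

theorem subId_apply (τ : q.IsometryEquiv q) (x : V) : subId τ x = τ x - x := rfl

/-- The fixed space `k(τ) = {x | τ x = x}`. -/
def fixedSpace (τ : q.IsometryEquiv q) : Submodule F V where
  carrier := {x | τ x = x}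
  add_mem' {x y} hx hy := by
    have h : τ.toLinearEquiv (x + y) = τ.toLinearEquiv x + τ.toLinearEquiv y := map_add _ x y
    exact h.trans (congrArg₂ (· + ·) hx hy)
  zero_mem' := map_zero τ.toLinearEquiv
  smul_mem' c x hx := by
    have h : τ.toLinearEquiv (c • x) = c • τ.toLinearEquiv x := map_smul _ c x
    exact h.trans (congrArg (c • ·) hx)

/-- The residual space `r(τ) = {τ x - x | x ∈ V}`. -/
def residualSpace (τ : q.IsometryEquiv q) : Submodule F V := LinearMap.range (subId τ)

/-- The number `b_q(τ x - x, y)` depends on `y` only through `τ y - y`. -/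
theorem polar_eq_of_subId_eq (τ : q.IsometryEquiv q) {u y y' : V} (hu : u ∈ residualSpace τ)
    (h : subId τ y = subId τ y') :
    QuadraticMap.polar q u y = QuadraticMap.polar q u y' := by
  obtain ⟨x, rfl⟩ := hu
  have hm : ∀ a b : V, QuadraticMap.polar q (τ a) (τ b) = QuadraticMap.polar q a b := by
    intro a b
    have h : τ (a + b) = τ a + τ b := map_add τ.toLinearEquiv a b
    simp only [QuadraticMap.polar, ← h, QuadraticMap.IsometryEquiv.map_app]
  have hz : τ (y - y') = y - y' := by
    have h1 : τ (y - y') = τ y - τ y' := map_sub τ.toLinearEquiv y y'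
    rw [subId_apply, subId_apply] at h
    rw [h1, sub_eq_sub_iff_sub_eq_sub.mp h]
  rw [← sub_eq_zero, ← QuadraticMap.polar_sub_right, subId_apply, QuadraticMap.polar_sub_left]
  have h2 := hm x (y - y')
  rw [hz] at h2
  rw [h2, sub_self]

/-- The Wall form `ω_τ` of `τ`, the bilinear form on `r(τ)` given by
`ω_τ(τ x - x, τ y - y) = b_q(τ x - x, y)`; see `wallForm_apply`. -/
noncomputable def wallForm (τ : q.IsometryEquiv q) :
    LinearMap.BilinForm F (residualSpace τ) :=
  LinearMap.mk₂ F (fun u v => QuadraticMap.polar q (u : V) v.2.choose)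
    (fun u u' v => by simp [QuadraticMap.polar_add_left])
    (fun c u v => by simp [QuadraticMap.polar_smul_left])
    (fun u v v' => by
      rw [← QuadraticMap.polar_add_right]
      refine polar_eq_of_subId_eq τ u.2 ?_
      rw [(v + v').2.choose_spec, map_add, v.2.choose_spec, v'.2.choose_spec]
      rfl)
    (fun c u v => by
      rw [← QuadraticMap.polar_smul_right]
      refine polar_eq_of_subId_eq τ u.2 ?_
      rw [(c • v).2.choose_spec, map_smul, v.2.choose_spec]
      rfl)

/-- The defining formula of the Wall form. -/
theorem wallForm_apply (τ : q.IsometryEquiv q) (x y : V) :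
    wallForm τ ⟨τ x - x, x, rfl⟩ ⟨τ y - y, y, rfl⟩ = QuadraticMap.polar q (τ x - x) y := by
  refine polar_eq_of_subId_eq τ ⟨x, rfl⟩ ?_
  exact (⟨τ y - y, y, rfl⟩ : residualSpace τ).2.choose_spec

/-- The involution `J_τ` of the Clifford algebra `C(q)` induced by an isometry `τ` with
`τ² = id`: the anti-automorphism of `C(q)` with `J_τ(v) = τ v` for `v ∈ V`
(see `cliffordInvolution_ι`). -/
def cliffordInvolution (τ : q.IsometryEquiv q) (hτ : ∀ x, τ (τ x) = x) :
    AlgInvolution F (CliffordAlgebra q) where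
  toLinearMap := CliffordAlgebra.reverse ∘ₗ (CliffordAlgebra.map τ.toIsometry).toLinearMap
  map_mul' a b := by
    change CliffordAlgebra.reverse (CliffordAlgebra.map τ.toIsometry (a * b)) =
      CliffordAlgebra.reverse (CliffordAlgebra.map τ.toIsometry b) *
        CliffordAlgebra.reverse (CliffordAlgebra.map τ.toIsometry a)
    rw [map_mul, CliffordAlgebra.reverse.map_mul]
  involutive' a := by
    change CliffordAlgebra.reverse (CliffordAlgebra.map τ.toIsometry
      (CliffordAlgebra.reverse (CliffordAlgebra.map τ.toIsometry a))) = a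
    induction a using CliffordAlgebra.induction with
    | algebraMap r => simp
    | ι x => simp [hτ]
    | mul a b ha hb => simp [CliffordAlgebra.reverse.map_mul, ha, hb]
    | add a b ha hb => simp [ha, hb]

theorem cliffordInvolution_ι (τ : q.IsometryEquiv q) (hτ : ∀ x, τ (τ x) = x) (v : V) :
    cliffordInvolution τ hτ (CliffordAlgebra.ι q v) = CliffordAlgebra.ι q (τ v) := by
  change CliffordAlgebra.reverse (CliffordAlgebra.map τ.toIsometry (CliffordAlgebra.ι q v)) = _
  simp

/-- The involution `J_id` of `C(q)`, which fixes every vector. -/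
def cliffordInvolutionId (q : QuadraticForm F V) : AlgInvolution F (CliffordAlgebra q) :=
  cliffordInvolution (QuadraticMap.IsometryEquiv.refl q) (fun _ => rfl)

end QuadIsometry

/-! Since `τ` is an involutory isometry, `τ - 1` is self-adjoint for the polar form, so r(τ) and
k(τ) are orthogonal complements of each other. Hence W meets its orthogonal only in W ∩ r(τ) = 0,
and V is the orthogonal sum of W, where `τ` is the identity, and W^⊥, which has dimension 2s and on
which every fixed vector has the form τz - z. In characteristic 2 vectors from orthogonal summands
commute in the Clifford algebra, so orthogonal `τ`-stable decompositions become ungraded tensor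
products of algebras with involution (`isomorphic_tensor_perp`). It remains to show that W^⊥
contributes (M_{2^s}(F), t). Alternation of the Wall form means b(τx, x) = 0 for all x. This makes
every vector of r(τ) isotropic and lets W^⊥ be split into 4-dimensional blocks
(`exists_isTwistFrame`), each a sum of two hyperbolic planes on which `τ` is `hyperbolicTwist`. An
explicit spin representation identifies a block with (M_4(F), t) (`hyperbolicTwist_isomorphic`).
Kronecker products assemble the blocks by induction (`isomorphic_transpose_of_fixed`). -/

/-! ### Tensor products of algebras with involution. -/

namespace AlgInvolution

variable {F A B C A' B' : Type*} [Field F] [Ring A] [Algebra F A] [Ring B] [Algebra F B]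
  [Ring C] [Algebra F C] [Ring A'] [Algebra F A'] [Ring B'] [Algebra F B']

theorem apply_one (σ : AlgInvolution F A) : σ 1 = 1 := by
  have h1 := σ.map_mul' (σ 1) 1
  have h2 : σ.toLinearMap (σ 1) = 1 := σ.involutive' 1
  change σ.toLinearMap (σ 1 * 1) = σ 1 * σ.toLinearMap (σ 1) at h1
  rw [mul_one, h2, mul_one] at h1
  exact h1.symm

theorem tensor_tmul (σ : AlgInvolution F A) (σ' : AlgInvolution F B) (a : A) (b : B) :
    σ.tensor σ' (a ⊗ₜ b) = σ a ⊗ₜ σ' b := rfl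

theorem Isomorphic.trans {σ : AlgInvolution F A} {σ' : AlgInvolution F B}
    {σ'' : AlgInvolution F C} (h : σ.Isomorphic σ') (h' : σ'.Isomorphic σ'') :
    σ.Isomorphic σ'' := by
  obtain ⟨e, he⟩ := h
  obtain ⟨f, hf⟩ := h'
  exact ⟨e.trans f, fun a => by simp only [AlgEquiv.trans_apply, he, hf]⟩

theorem Isomorphic.tensor {σ : AlgInvolution F A} {σ' : AlgInvolution F A'}
    {ρ : AlgInvolution F B} {ρ' : AlgInvolution F B'} (h : σ.Isomorphic σ')
    (h' : ρ.Isomorphic ρ') : (σ.tensor ρ).Isomorphic (σ'.tensor ρ') := by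
  obtain ⟨e, he⟩ := h
  obtain ⟨f, hf⟩ := h'
  refine ⟨Algebra.TensorProduct.congr e f, fun x => ?_⟩
  induction x using TensorProduct.induction_on with
  | zero => simp
  | add x y hx hy => simp only [map_add, hx, hy]
  | tmul a b =>
    simp only [tensor_tmul, Algebra.TensorProduct.congr_apply, Algebra.TensorProduct.map_tmul]
    simp [he, hf]

theorem transpose_apply (n : ℕ) (M : Matrix (Fin n) (Fin n) F) : transpose F n M = M.transpose :=
  rfl

/-- The Kronecker product of matrix algebras is compatible with transposition. -/
theorem transpose_tensor_transpose (m n : ℕ) :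
    ((transpose F m).tensor (transpose F n)).Isomorphic (transpose F (m * n)) := by
  refine ⟨((Matrix.kroneckerTMulAlgEquiv (Fin m) (Fin n) F F F F).trans
    (AlgEquiv.mapMatrix (Algebra.TensorProduct.lid F F))).trans
    (Matrix.reindexAlgEquiv F F finProdFinEquiv), fun x => ?_⟩
  induction x using TensorProduct.induction_on with
  | zero => simp
  | add x y hx hy => simp only [map_add, hx, hy]
  | tmul a b =>
    ext i j
    simp [tensor_tmul, transpose_apply]

end AlgInvolution

/-! ### Clifford algebras of orthogonal sums in characteristic two. -/

namespace QuadIsometry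

variable {F V V₁ V₂ B : Type*} [Field F] [AddCommGroup V] [Module F V] [AddCommGroup V₁]
  [Module F V₁] [AddCommGroup V₂] [Module F V₂] [Ring B] [Algebra F B]
  {q : QuadraticForm F V} {q₁ : QuadraticForm F V₁} {q₂ : QuadraticForm F V₂}

/-- An algebra isomorphism out of a Clifford algebra respects the involutions as soon as it does so
on vectors. -/
theorem isomorphic_of_ι (τ : q.IsometryEquiv q) (hτ : ∀ x, τ (τ x) = x) (σ : AlgInvolution F B)
    (e : CliffordAlgebra q ≃ₐ[F] B)
    (h : ∀ v, σ (e (CliffordAlgebra.ι q v)) = e (CliffordAlgebra.ι q (τ v))) :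
    (cliffordInvolution τ hτ).Isomorphic σ := by
  refine ⟨e, fun a => ?_⟩
  induction a using CliffordAlgebra.induction with
  | algebraMap r =>
    simp only [Algebra.algebraMap_eq_smul_one, map_smul, AlgInvolution.apply_one, map_one]
  | ι x => rw [cliffordInvolution_ι, h]
  | mul a b ha hb =>
    have h1 : cliffordInvolution τ hτ (a * b)
      = cliffordInvolution τ hτ b * cliffordInvolution τ hτ a :=
      (cliffordInvolution τ hτ).map_mul' a b
    have h2 : σ (e a * e b) = σ (e b) * σ (e a) := σ.map_mul' _ _
    rw [h1, map_mul, map_mul, h2, ha, hb]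
  | add a b ha hb => simp only [map_add, ha, hb]

variable [CharP F 2]

theorem add_self_eq_zero_of_algebra {A : Type*} [Ring A] [Algebra F A] (a : A) : a + a = 0 := by
  rw [← two_smul F a, CharTwo.two_eq_zero, zero_smul]

/-- In characteristic two, the Clifford algebra of an orthogonal sum maps to the (ungraded) tensor
product of the Clifford algebras. -/
noncomputable def prodToTensor (q₁ : QuadraticForm F V₁) (q₂ : QuadraticForm F V₂) :
    CliffordAlgebra (q₁.prod q₂) →ₐ[F] CliffordAlgebra q₁ ⊗[F] CliffordAlgebra q₂ :=
  CliffordAlgebra.lift _ ⟨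
    (Algebra.TensorProduct.includeLeft (S := F)).toLinearMap ∘ₗ CliffordAlgebra.ι q₁ ∘ₗ
        LinearMap.fst F V₁ V₂ +
      Algebra.TensorProduct.includeRight.toLinearMap ∘ₗ CliffordAlgebra.ι q₂ ∘ₗ
        LinearMap.snd F V₁ V₂, by
    rintro ⟨a, b⟩
    -- The two cross terms of the square coincide, so they cancel in characteristic 2.
    have h := add_self_eq_zero_of_algebra (F := F)
      (CliffordAlgebra.ι q₁ a ⊗ₜ[F] CliffordAlgebra.ι q₂ b)
    simp only [LinearMap.add_apply, LinearMap.comp_apply, LinearMap.fst_apply,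
      LinearMap.snd_apply, AlgHom.toLinearMap_apply, Algebra.TensorProduct.includeLeft_apply,
      Algebra.TensorProduct.includeRight_apply, add_mul, mul_add,
      Algebra.TensorProduct.tmul_mul_tmul, CliffordAlgebra.ι_sq_scalar, one_mul, mul_one,
      QuadraticMap.prod_apply, map_add]
    rw [Algebra.TensorProduct.algebraMap_apply, Algebra.TensorProduct.algebraMap_apply',
      ← add_assoc, add_assoc _ _ (CliffordAlgebra.ι q₁ a ⊗ₜ[F] CliffordAlgebra.ι q₂ b), h, add_zero]⟩

theorem prodToTensor_ι (a : V₁) (b : V₂) :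
    prodToTensor q₁ q₂ (CliffordAlgebra.ι _ (a, b)) =
      CliffordAlgebra.ι q₁ a ⊗ₜ 1 + 1 ⊗ₜ CliffordAlgebra.ι q₂ b := by
  rw [prodToTensor, CliffordAlgebra.lift_ι_apply]
  rfl

theorem commute_map_inl_inr (x : CliffordAlgebra q₁) (y : CliffordAlgebra q₂) :
    Commute (CliffordAlgebra.map (QuadraticMap.Isometry.inl q₁ q₂) x)
      (CliffordAlgebra.map (QuadraticMap.Isometry.inr q₁ q₂) y) := by
  induction x using CliffordAlgebra.induction with
  | algebraMap r => rw [AlgHom.commutes]; exact Algebra.commutes r _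
  | mul a b ha hb => rw [map_mul]; exact ha.mul_left hb
  | add a b ha hb => rw [map_add]; exact ha.add_left hb
  | ι a =>
    induction y using CliffordAlgebra.induction with
    | algebraMap r => rw [AlgHom.commutes]; exact (Algebra.commutes r _).symm
    | mul c d hc hd => rw [map_mul]; exact hc.mul_right hd
    | add c d hc hd => rw [map_add]; exact hc.add_right hd
    | ι b =>
      rw [CliffordAlgebra.map_apply_ι, CliffordAlgebra.map_apply_ι, commute_iff_eq]
      -- Orthogonal vectors anticommute, which is commuting here because -1 = 1.
      refine (CliffordAlgebra.ι_mul_ι_comm_of_isOrtho (QuadraticMap.IsOrtho.inl_inr a b)).trans ?_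
      exact (eq_neg_of_add_eq_zero_left (add_self_eq_zero_of_algebra (F := F) _)).symm

/-- The inverse of `prodToTensor`. -/
noncomputable def tensorToProd (q₁ : QuadraticForm F V₁) (q₂ : QuadraticForm F V₂) :
    CliffordAlgebra q₁ ⊗[F] CliffordAlgebra q₂ →ₐ[F] CliffordAlgebra (q₁.prod q₂) :=
  Algebra.TensorProduct.lift (CliffordAlgebra.map (QuadraticMap.Isometry.inl q₁ q₂))
    (CliffordAlgebra.map (QuadraticMap.Isometry.inr q₁ q₂)) commute_map_inl_inr

/-- In characteristic two, the Clifford algebra of an orthogonal sum is the (ungraded) tensor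
product of the Clifford algebras. -/
noncomputable def prodEquivTensor (q₁ : QuadraticForm F V₁) (q₂ : QuadraticForm F V₂) :
    CliffordAlgebra (q₁.prod q₂) ≃ₐ[F] CliffordAlgebra q₁ ⊗[F] CliffordAlgebra q₂ :=
  AlgEquiv.ofAlgHom (prodToTensor q₁ q₂) (tensorToProd q₁ q₂)
    (by
      apply Algebra.TensorProduct.ext
      · ext a
        simp [tensorToProd, prodToTensor_ι]
      · ext a
        simp [tensorToProd, prodToTensor_ι])
    (by
      apply CliffordAlgebra.hom_ext
      ext a
      · simp [tensorToProd, prodToTensor_ι]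
      · simp [tensorToProd, prodToTensor_ι])

/-- In characteristic two, an orthogonal decomposition of a quadratic space that is compatible with
involutory isometries decomposes the corresponding Clifford algebra with involution. -/
theorem isomorphic_tensor (τ : q.IsometryEquiv q) (hτ : ∀ x, τ (τ x) = x)
    (τ₁ : q₁.IsometryEquiv q₁) (hτ₁ : ∀ x, τ₁ (τ₁ x) = x)
    (τ₂ : q₂.IsometryEquiv q₂) (hτ₂ : ∀ x, τ₂ (τ₂ x) = x)
    (e : V ≃ₗ[F] V₁ × V₂) (he : ∀ a b, q (e.symm (a, b)) = q₁ a + q₂ b)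
    (heτ : ∀ a b, τ (e.symm (a, b)) = e.symm (τ₁ a, τ₂ b)) :
    (cliffordInvolution τ hτ).Isomorphic
      ((cliffordInvolution τ₁ hτ₁).tensor (cliffordInvolution τ₂ hτ₂)) := by
  let f : q.IsometryEquiv (q₁.prod q₂) := ⟨e, fun v => by
    obtain ⟨⟨a, b⟩, rfl⟩ := e.symm.surjective v
    rw [he]
    simp⟩
  refine isomorphic_of_ι τ hτ _ ((CliffordAlgebra.equivOfIsometry f).trans
    (prodEquivTensor q₁ q₂)) fun v => ?_
  obtain ⟨⟨a, b⟩, rfl⟩ := e.symm.surjective v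
  have h1 : ∀ z, prodEquivTensor q₁ q₂ z = prodToTensor q₁ q₂ z := fun _ => rfl
  simp only [AlgEquiv.trans_apply, CliffordAlgebra.equivOfIsometry_apply,
    CliffordAlgebra.map_apply_ι, h1]
  change _ = prodToTensor q₁ q₂ (CliffordAlgebra.ι _ (e _))
  change AlgInvolution.tensor _ _ (prodToTensor q₁ q₂ (CliffordAlgebra.ι _ (e _))) = _
  rw [heτ, e.apply_symm_apply, e.apply_symm_apply, prodToTensor_ι, prodToTensor_ι, map_add,
    AlgInvolution.tensor_tmul, AlgInvolution.tensor_tmul, cliffordInvolution_ι,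
    cliffordInvolution_ι, AlgInvolution.apply_one,
    AlgInvolution.apply_one]

end QuadIsometry

/-! ### The four-dimensional model and its spin representation. -/

namespace QuadIsometry

variable (F : Type*) [Field F]

/-- The hyperbolic plane. -/
def hyperbolicPlane : QuadraticForm F (F × F) :=
  QuadraticMap.linMulLin (LinearMap.fst F F F) (LinearMap.snd F F F)

theorem hyperbolicPlane_apply (a b : F) : hyperbolicPlane F (a, b) = a * b := rfl

/-- The Clifford algebra of a hyperbolic plane has dimension at most four. -/
theorem finrank_cliffordAlgebra_hyperbolicPlane_le :
    Module.Finite F (CliffordAlgebra (hyperbolicPlane F)) ∧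
      Module.finrank F (CliffordAlgebra (hyperbolicPlane F)) ≤ 4 := by
  set X := CliffordAlgebra.ι (hyperbolicPlane F) (1, 0) with hX
  set Y := CliffordAlgebra.ι (hyperbolicPlane F) (0, 1) with hY
  have hXX : X * X = 0 := by simp [hX, CliffordAlgebra.ι_sq_scalar, hyperbolicPlane_apply]
  have hYY : Y * Y = 0 := by simp [hY, CliffordAlgebra.ι_sq_scalar, hyperbolicPlane_apply]
  have hYX : Y * X = 1 - X * Y := by
    rw [hX, hY, CliffordAlgebra.ι_mul_ι_comm]
    simp [QuadraticMap.polar, hyperbolicPlane_apply]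
  let g : Fin 4 → CliffordAlgebra (hyperbolicPlane F) := ![1, X, Y, X * Y]
  -- The span of 1, X, Y, XY contains 1 and is stable under left multiplication by X and Y, hence is
  -- everything.
  have hmem : ∀ i, g i ∈ Submodule.span F (Set.range g) := fun i =>
    Submodule.subset_span ⟨i, rfl⟩
  have h0 : (1 : CliffordAlgebra (hyperbolicPlane F)) ∈ Submodule.span F (Set.range g) := hmem 0
  have h1 : X ∈ Submodule.span F (Set.range g) := hmem 1
  have h2 : Y ∈ Submodule.span F (Set.range g) := hmem 2
  have h3 : X * Y ∈ Submodule.span F (Set.range g) := hmem 3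
  have hXs : ∀ z ∈ Submodule.span F (Set.range g), X * z ∈ Submodule.span F (Set.range g) := by
    intro z hz
    induction hz using Submodule.span_induction with
    | zero => simp
    | add z w _ _ hz hw => rw [mul_add]; exact add_mem hz hw
    | smul c z _ hz => rw [mul_smul_comm]; exact Submodule.smul_mem _ c hz
    | mem z hz =>
      obtain ⟨i, rfl⟩ := hz
      fin_cases i
      · simpa [g] using h1
      · simp [g, hXX]
      · simpa [g] using h3
      · simp [g, ← mul_assoc, hXX]
  have hYs : ∀ z ∈ Submodule.span F (Set.range g), Y * z ∈ Submodule.span F (Set.range g) := by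
    intro z hz
    induction hz using Submodule.span_induction with
    | zero => simp
    | add z w _ _ hz hw => rw [mul_add]; exact add_mem hz hw
    | smul c z _ hz => rw [mul_smul_comm]; exact Submodule.smul_mem _ c hz
    | mem z hz =>
      obtain ⟨i, rfl⟩ := hz
      fin_cases i
      · simpa [g] using h2
      · simpa [g, hYX] using sub_mem h0 h3
      · simp [g, hYY]
      · simpa [g, ← mul_assoc, hYX, sub_mul, mul_assoc X, hYY] using h2
  have htop : Submodule.span F (Set.range g) = ⊤ := by
    rw [eq_top_iff]
    rintro z -
    induction z using CliffordAlgebra.left_induction with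
    | algebraMap r => rw [Algebra.algebraMap_eq_smul_one]; exact Submodule.smul_mem _ r h0
    | add z w hz hw => exact add_mem hz hw
    | ι_mul z v hz =>
      obtain ⟨a, b⟩ := v
      have hv : CliffordAlgebra.ι (hyperbolicPlane F) (a, b) = a • X + b • Y := by
        rw [hX, hY, ← map_smul, ← map_smul, ← map_add]
        simp
      rw [hv, add_mul, smul_mul_assoc, smul_mul_assoc]
      exact add_mem (Submodule.smul_mem _ a (hXs z hz)) (Submodule.smul_mem _ b (hYs z hz))
  classical
  refine ⟨⟨⟨Finset.univ.image g, by simpa using htop⟩⟩, ?_⟩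
  have := finrank_range_le_card (R := F) g
  rwa [Set.finrank, htop, finrank_top, Fintype.card_fin] at this

/-- The vectors of the sum of two hyperbolic planes, as `4 × 4` matrices: the spin representation in
an orthonormal basis for the bilinear form adjoint to the involution of `hyperbolicTwist`. -/
def twistMatrix : (F × F) × (F × F) →ₗ[F] Matrix (Fin 4) (Fin 4) F where
  toFun p := !![0, p.1.2 + p.2.1, p.1.1 + p.2.2, p.1.1 + p.1.2 + p.2.1 + p.2.2;
      p.1.2, p.2.1, p.1.2 + p.2.1 + p.2.2, p.2.1 + p.2.2;
      p.2.2, p.1.1 + p.1.2 + p.2.2, p.1.1, p.1.1 + p.1.2;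
      p.1.2 + p.2.2, p.1.1 + p.2.1 + p.2.2, p.1.1 + p.1.2 + p.2.1, p.1.1 + p.2.1]
  map_add' p p' := by
    ext i j
    fin_cases i <;> fin_cases j <;> simp <;> ring
  map_smul' c p := by
    ext i j
    fin_cases i <;> fin_cases j <;> simp <;> ring

theorem twistMatrix_apply (a b c d : F) : twistMatrix F ((a, b), (c, d)) =
    !![0, b + c, a + d, a + b + c + d; b, c, b + c + d, c + d;
      d, a + b + d, a, a + b; b + d, a + c + d, a + b + c, a + c] := rfl

variable [CharP F 2]

theorem twistMatrix_mul_self (p) : twistMatrix F p * twistMatrix F p =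
    algebraMap F _ ((hyperbolicPlane F).prod (hyperbolicPlane F) p) := by
  obtain ⟨⟨a, b⟩, c, d⟩ := p
  have h2 : (2 : F) = 0 := CharTwo.two_eq_zero
  rw [twistMatrix_apply, QuadraticMap.prod_apply, hyperbolicPlane_apply, hyperbolicPlane_apply]
  ext i j
  fin_cases i <;> fin_cases j <;>
    simp [Matrix.mul_apply, Fin.sum_univ_four, Matrix.algebraMap_matrix_apply] <;> grind

/-- The spin representation of the sum of two hyperbolic planes. -/
def twistHom : CliffordAlgebra ((hyperbolicPlane F).prod (hyperbolicPlane F)) →ₐ[F]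
    Matrix (Fin 4) (Fin 4) F :=
  CliffordAlgebra.lift _ ⟨twistMatrix F, twistMatrix_mul_self F⟩

theorem twistHom_ι (p) : twistHom F (CliffordAlgebra.ι _ p) = twistMatrix F p :=
  CliffordAlgebra.lift_ι_apply _ _ _

/-- The image contains all matrix units: one of them, E₀₀, is a polynomial in the four generators,
and the others are C_i E₀₀ C_j, where C_i has the i-th basis vector as both first column and first
row. -/
theorem twistHom_surjective : Function.Surjective (twistHom F) := by
  have hι : ∀ p, twistMatrix F p ∈ (twistHom F).range := fun p => ⟨_, twistHom_ι F p⟩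
  have hX := hι ((1, 0), (0, 0))
  have hV := hι ((0, 1), (0, 0))
  have hY := hι ((0, 0), (1, 0))
  have hU := hι ((0, 0), (0, 1))
  have hJ := (twistHom F).range.mul_mem hU hV
  have hE := (twistHom F).range.add_mem (mul_mem (mul_mem hY hU) (mul_mem hX hV)) (mul_mem hX hY)
  have h1 := (twistHom F).range.one_mem
  simp only [twistMatrix_apply] at hX hV hY hU hJ hE
  have hE' : Matrix.single (0 : Fin 4) (0 : Fin 4) (1 : F) ∈ (twistHom F).range := by
    convert hE using 1
    ext i j
    fin_cases i <;> fin_cases j <;>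
      simp [CharTwo.add_self_eq_zero]
  -- The first row of 1 + UV is (0, 1, 1, 1), while those of U and V are (0, 0, 1, 1) and (0, 1, 0,
  -- 1). Adding U, V or U + V isolates each remaining basis vector.
  have hC : ∀ i : Fin 4, ∃ C ∈ (twistHom F).range,
      (∀ k, C k 0 = if k = i then 1 else 0) ∧ (∀ k, C 0 k = if k = i then 1 else 0) := by
    intro i
    fin_cases i
    · exact ⟨1, h1, fun k => Matrix.one_apply, fun k => Matrix.one_apply.trans (by simp [eq_comm])⟩
    · refine ⟨_, add_mem (add_mem h1 hJ) hU, ?_, ?_⟩ <;> intro k <;> fin_cases k <;>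
        simp [CharTwo.add_self_eq_zero]
    · refine ⟨_, add_mem (add_mem h1 hJ) hV, ?_, ?_⟩ <;> intro k <;> fin_cases k <;>
        simp [CharTwo.add_self_eq_zero]
    · refine ⟨_, add_mem (add_mem (add_mem h1 hJ) hU) hV, ?_, ?_⟩ <;> intro k <;> fin_cases k <;>
        simp [CharTwo.add_self_eq_zero]
  have hS : ∀ i j : Fin 4, Matrix.single i j (1 : F) ∈ (twistHom F).range := by
    intro i j
    obtain ⟨C, hCm, hC0, -⟩ := hC i
    obtain ⟨D, hDm, -, hD0⟩ := hC j
    convert mul_mem (mul_mem hCm hE') hDm using 1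
    ext k l
    simp [Matrix.mul_apply, Matrix.single_apply, hC0, hD0, ite_and, eq_comm]
  intro M
  change M ∈ (twistHom F).range
  rw [Matrix.matrix_eq_sum_single M]
  refine sum_mem fun i _ => sum_mem fun j _ => ?_
  have := (twistHom F).range.smul_mem (hS i j) (M i j)
  rwa [Matrix.smul_single, smul_eq_mul, mul_one] at this

/-- The source has dimension at most 4 · 4 = 16 = dim M_4(F), so surjectivity forces bijectivity. -/
theorem twistHom_bijective : Function.Bijective (twistHom F) := by
  obtain ⟨hf, hr⟩ := finrank_cliffordAlgebra_hyperbolicPlane_le F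
  have e := (prodEquivTensor (hyperbolicPlane F) (hyperbolicPlane F)).toLinearEquiv
  have : Module.Finite F (CliffordAlgebra ((hyperbolicPlane F).prod (hyperbolicPlane F))) :=
    Module.Finite.equiv e.symm
  have hle : Module.finrank F (CliffordAlgebra ((hyperbolicPlane F).prod (hyperbolicPlane F))) ≤
      Module.finrank F (Matrix (Fin 4) (Fin 4) F) := by
    rw [e.finrank_eq, Module.finrank_tensorProduct, Module.finrank_matrix]
    simpa using Nat.mul_le_mul hr hr
  have hs : Function.Surjective (twistHom F).toLinearMap := twistHom_surjective F
  have heq := le_antisymm hle (LinearMap.finrank_le_finrank_of_surjective hs)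
  exact ⟨(LinearMap.injective_iff_surjective_of_finrank_eq_finrank heq).2 hs, hs⟩

/-- The involutory isometry of a sum of two hyperbolic planes, with bases `(x, v)` and `(y, u)`,
that fixes `u` and `v`, and maps `x` to `x + u` and `y` to `y + v`. -/
def hyperbolicTwist : ((hyperbolicPlane F).prod (hyperbolicPlane F)).IsometryEquiv
    ((hyperbolicPlane F).prod (hyperbolicPlane F)) where
  toFun p := ((p.1.1, p.1.2 + p.2.1), (p.2.1, p.2.2 + p.1.1))
  invFun p := ((p.1.1, p.1.2 - p.2.1), (p.2.1, p.2.2 - p.1.1))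
  map_add' p p' := by
    ext <;> simp <;> ring
  map_smul' c p := by
    ext <;> simp <;> ring
  left_inv p := by simp
  right_inv p := by simp
  map_app' p := by
    obtain ⟨⟨a, b⟩, c, d⟩ := p
    simp only [QuadraticMap.prod_apply, hyperbolicPlane_apply]
    linear_combination (a * c) * CharTwo.two_eq_zero (R := F)

theorem hyperbolicTwist_apply (a b c d : F) :
    hyperbolicTwist F ((a, b), (c, d)) = ((a, b + c), (c, d + a)) := rfl

theorem hyperbolicTwist_involutive (p) : hyperbolicTwist F (hyperbolicTwist F p) = p := by
  obtain ⟨⟨a, b⟩, c, d⟩ := p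
  simp [hyperbolicTwist_apply, add_assoc, CharTwo.add_self_eq_zero]

/-- The Clifford algebra with involution of `hyperbolicTwist` is `(M₄(F), t)`. -/
theorem hyperbolicTwist_isomorphic :
    (cliffordInvolution (hyperbolicTwist F) (hyperbolicTwist_involutive F)).Isomorphic
      (AlgInvolution.transpose F 4) := by
  refine isomorphic_of_ι _ _ _ (AlgEquiv.ofBijective (twistHom F) (twistHom_bijective F))
    fun v => ?_
  obtain ⟨⟨a, b⟩, c, d⟩ := v
  have h2 : (2 : F) = 0 := CharTwo.two_eq_zero
  simp only [AlgEquiv.coe_ofBijective, twistHom_ι, hyperbolicTwist_apply, twistMatrix_apply,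
    AlgInvolution.transpose_apply]
  -- On generators: U and V are symmetric, Xᵗ = X + U and Yᵗ = Y + V.
  ext i j
  fin_cases i <;> fin_cases j <;> simp <;> ring_nf <;> simp [h2]

end QuadIsometry

/-! ### Finding a block inside a quadratic space with involution. -/

namespace QuadIsometry

variable {F V : Type*} [Field F] [AddCommGroup V] [Module F V] {q : QuadraticForm F V}

/-- The restriction of an involutory isometry to a stable subspace. -/
def restrictIsometry (τ : q.IsometryEquiv q) (hτ : ∀ x, τ (τ x) = x) (U : Submodule F V)
    (hU : ∀ x ∈ U, τ x ∈ U) : (q.restrict U).IsometryEquiv (q.restrict U) where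
  toLinearEquiv := LinearEquiv.ofInvolutive
    ((τ.toLinearEquiv : V →ₗ[F] V).restrict hU) fun x => Subtype.ext (hτ x)
  map_app' x := τ.map_app x

theorem coe_restrictIsometry (τ : q.IsometryEquiv q) (hτ : ∀ x, τ (τ x) = x) (U : Submodule F V)
    (hU : ∀ x ∈ U, τ x ∈ U) (x : U) : (restrictIsometry τ hτ U hU x : V) = τ x := rfl

theorem restrictIsometry_involutive (τ : q.IsometryEquiv q) (hτ : ∀ x, τ (τ x) = x)
    (U : Submodule F V) (hU : ∀ x ∈ U, τ x ∈ U) (x : U) :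
    restrictIsometry τ hτ U hU (restrictIsometry τ hτ U hU x) = x := Subtype.ext (hτ x)

theorem polar_isometry (τ : q.IsometryEquiv q) (a b : V) :
    QuadraticMap.polar q (τ a) (τ b) = QuadraticMap.polar q a b := by
  have h : τ (a + b) = τ a + τ b := map_add τ.toLinearEquiv a b
  simp only [QuadraticMap.polar, ← h, QuadraticMap.IsometryEquiv.map_app]

theorem polar_isometry_left (τ : q.IsometryEquiv q) (hτ : ∀ x, τ (τ x) = x) (a b : V) :
    QuadraticMap.polar q (τ a) b = QuadraticMap.polar q a (τ b) := by
  rw [← polar_isometry τ, hτ]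

/-- The vectors `x, v, y, u` span a sum of two orthogonal hyperbolic planes, on which `τ` is the
model isometry `hyperbolicTwist`. -/
structure IsTwistFrame (τ : q.IsometryEquiv q) (x v y u : V) : Prop where
  map_x : q x = 0
  map_v : q v = 0
  map_y : q y = 0
  map_u : q u = 0
  polar_xv : QuadraticMap.polar q x v = 1
  polar_yu : QuadraticMap.polar q y u = 1
  polar_xy : QuadraticMap.polar q x y = 0
  polar_xu : QuadraticMap.polar q x u = 0
  polar_vy : QuadraticMap.polar q v y = 0
  polar_vu : QuadraticMap.polar q v u = 0
  isometry_x : τ x = x + u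
  isometry_v : τ v = v
  isometry_y : τ y = y + v
  isometry_u : τ u = u

/-- The linear map from the sum of two hyperbolic planes to the span of four vectors. -/
def frameMap (F : Type*) [Field F] [Module F V] (x v y u : V) : (F × F) × (F × F) →ₗ[F] V :=
  ((LinearMap.toSpanSingleton F V x).coprod (LinearMap.toSpanSingleton F V v)).coprod
    ((LinearMap.toSpanSingleton F V y).coprod (LinearMap.toSpanSingleton F V u))

theorem frameMap_apply (x v y u : V) (a b c d : F) :
    frameMap F x v y u ((a, b), (c, d)) = a • x + b • v + (c • y + d • u) := by
  simp [frameMap]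

variable [CharP F 2]

theorem polar_self_eq_zero (q : QuadraticForm F V) (x : V) : QuadraticMap.polar q x x = 0 := by
  rw [QuadraticMap.polar_self, CharTwo.two_nsmul]

/-- Choose x₁ with u = τx₁ + x₁ nonzero, then y₁ with b(u, y₁) = 1, and put v = τy₁ + y₁.
Self-adjointness and `halt` give all relations involving u and v. Corrections by multiples of the
fixed vectors u and v then repair the rest without changing how `τ` acts. -/
theorem exists_isTwistFrame [Nontrivial V] (hq : (QuadraticMap.polarBilin q).Nondegenerate)
    (τ : q.IsometryEquiv q) (hτ : ∀ x, τ (τ x) = x)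
    (hfix : ∀ x, τ x = x → ∃ z, τ z - z = x)
    (halt : ∀ x, QuadraticMap.polar q (τ x) x = 0) :
    ∃ x v y u, IsTwistFrame τ x v y u := by
  have hadd : ∀ a b, τ (a + b) = τ a + τ b := map_add τ.toLinearEquiv
  have hsmul : ∀ (c : F) a, τ (c • a) = c • τ a := map_smul τ.toLinearEquiv
  have hneg : ∀ a : V, -a = a := fun a => by
    rw [← neg_one_smul F, CharTwo.neg_eq, one_smul]
  have hdouble : ∀ a : V, a + a = 0 := fun a => by
    nth_rw 1 [← hneg a]
    exact neg_add_cancel a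
  have hres : ∀ a, τ (τ a + a) = τ a + a := fun a => by rw [hadd, hτ, add_comm]
  have hsymm : ∀ a b, QuadraticMap.polar q a b = QuadraticMap.polar q b a :=
    QuadraticMap.polar_comm q
  have hqr : ∀ a, q (τ a + a) = 0 := fun a => by
    rw [QuadraticMap.map_add q, halt, τ.map_app, CharTwo.add_self_eq_zero, add_zero]
  -- Otherwise `τ` is the identity, and `hfix` would make every vector zero.
  obtain ⟨x₁, hx₁⟩ : ∃ z, τ z + z ≠ 0 := by
    by_contra! h
    obtain ⟨w, hw⟩ := exists_ne (0 : V)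
    obtain ⟨z, hz⟩ := hfix w (by rw [← sub_eq_zero, sub_eq_add_neg, hneg, h])
    rw [sub_eq_add_neg, hneg, h] at hz
    exact hw hz.symm
  obtain ⟨y₀, hy₀⟩ : ∃ y₀, QuadraticMap.polar q (τ x₁ + x₁) y₀ ≠ 0 := by
    by_contra! h
    exact hx₁ (hq.1 _ h)
  set u := τ x₁ + x₁ with hu
  obtain ⟨y₁, hy₁⟩ : ∃ y₁, QuadraticMap.polar q u y₁ = 1 :=
    ⟨(QuadraticMap.polar q u y₀)⁻¹ • y₀, by
      rw [QuadraticMap.polar_smul_right, smul_eq_mul, inv_mul_cancel₀ hy₀]⟩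
  set v := τ y₁ + y₁ with hv
  have hτu : τ u = u := hres _
  have hτv : τ v = v := hres _
  have hτx : τ x₁ = x₁ + u := by
    rw [hu, add_left_comm, hdouble, add_zero]
  have hτy : τ y₁ = y₁ + v := by
    rw [hv, add_left_comm, hdouble, add_zero]
  have hux : QuadraticMap.polar q u x₁ = 0 := by
    rw [hu, QuadraticMap.polar_add_left, halt, polar_self_eq_zero, add_zero]
  have hvy : QuadraticMap.polar q v y₁ = 0 := by
    rw [hv, QuadraticMap.polar_add_left, halt, polar_self_eq_zero, add_zero]
  have hvx : QuadraticMap.polar q v x₁ = 1 := by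
    rw [hv, QuadraticMap.polar_add_left, polar_isometry_left τ hτ, ← QuadraticMap.polar_add_right,
      ← hu, hsymm, hy₁]
  have huv : QuadraticMap.polar q u v = 0 := by
    rw [hv, QuadraticMap.polar_add_right, ← polar_isometry_left τ hτ, hτu,
      CharTwo.add_self_eq_zero]
  have hqu : q u = 0 := hqr x₁
  have hqv : q v = 0 := hqr y₁
  have hxu : QuadraticMap.polar q x₁ u = 0 := (hsymm _ _).trans hux
  have hxv : QuadraticMap.polar q x₁ v = 1 := (hsymm _ _).trans hvx
  have hyu : QuadraticMap.polar q y₁ u = 1 := (hsymm _ _).trans hy₁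
  have hvu : QuadraticMap.polar q v u = 0 := (hsymm _ _).trans huv
  have huu := polar_self_eq_zero q u
  have hvv := polar_self_eq_zero q v
  clear_value u v
  -- As b(u, y₁) = 1, adding b(x₁, y₁)u makes x₁ orthogonal to y₁.
  obtain ⟨x₂, hx₂u, hx₂v, hx₂y, hτx₂⟩ : ∃ x₂, QuadraticMap.polar q x₂ u = 0 ∧
      QuadraticMap.polar q x₂ v = 1 ∧ QuadraticMap.polar q x₂ y₁ = 0 ∧ τ x₂ = x₂ + u := by
    refine ⟨x₁ + QuadraticMap.polar q x₁ y₁ • u, ?_, ?_, ?_, ?_⟩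
    · rw [QuadraticMap.polar_add_left, QuadraticMap.polar_smul_left, hxu, huu, smul_zero, add_zero]
    · rw [QuadraticMap.polar_add_left, QuadraticMap.polar_smul_left, hxv, huv, smul_zero, add_zero]
    · rw [QuadraticMap.polar_add_left, QuadraticMap.polar_smul_left, hy₁, smul_eq_mul, mul_one,
        CharTwo.add_self_eq_zero]
    · rw [hadd, hsmul, hτu, hτx, add_right_comm]
  -- As v is isotropic and b(x₂, v) = 1, q(x₂ + q(x₂)v) = 2q(x₂) = 0; the correction of y₁ by u
  -- works alike.
  refine ⟨x₂ + q x₂ • v, v, y₁ + q y₁ • u, u, ?_, hqv, ?_, hqu, ?_, ?_, ?_, ?_, ?_, hvu, ?_,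
    hτv, ?_, hτu⟩
  · rw [QuadraticMap.map_add q, QuadraticMap.map_smul, hqv, QuadraticMap.polar_smul_right, hx₂v,
      smul_zero, add_zero, smul_eq_mul, mul_one, CharTwo.add_self_eq_zero]
  · rw [QuadraticMap.map_add q, QuadraticMap.map_smul, hqu, QuadraticMap.polar_smul_right, hyu,
      smul_zero, add_zero, smul_eq_mul, mul_one, CharTwo.add_self_eq_zero]
  · rw [QuadraticMap.polar_add_left, QuadraticMap.polar_smul_left, hx₂v, hvv, smul_zero, add_zero]
  · rw [QuadraticMap.polar_add_left, QuadraticMap.polar_smul_left, hyu, huu, smul_zero, add_zero]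
  · rw [QuadraticMap.polar_add_left, QuadraticMap.polar_smul_left, QuadraticMap.polar_add_right,
      QuadraticMap.polar_add_right, QuadraticMap.polar_smul_right, QuadraticMap.polar_smul_right,
      hx₂y, hx₂u, hvy, hvu]
    simp
  · rw [QuadraticMap.polar_add_left, QuadraticMap.polar_smul_left, hx₂u, hvu, smul_zero, add_zero]
  · rw [QuadraticMap.polar_add_right, QuadraticMap.polar_smul_right, hvy, hvu, smul_zero, add_zero]
  · rw [hadd, hsmul, hτv, hτx₂, add_right_comm]
  · rw [hadd, hsmul, hτu, hτy, add_right_comm]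

end QuadIsometry

/-! ### Splitting off a stable nondegenerate subspace. -/

namespace QuadIsometry

section

variable {F V V₁ : Type*} [Field F] [AddCommGroup V] [Module F V] [AddCommGroup V₁] [Module F V₁]
  {q : QuadraticForm F V} {q₁ : QuadraticForm F V₁}

theorem isomorphic_of_isometryEquiv (τ : q.IsometryEquiv q) (hτ : ∀ x, τ (τ x) = x)
    (τ₁ : q₁.IsometryEquiv q₁) (hτ₁ : ∀ x, τ₁ (τ₁ x) = x) (f : q.IsometryEquiv q₁)
    (hf : ∀ x, f (τ x) = τ₁ (f x)) :
    (cliffordInvolution τ hτ).Isomorphic (cliffordInvolution τ₁ hτ₁) := by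
  refine isomorphic_of_ι τ hτ _ (CliffordAlgebra.equivOfIsometry f) fun v => ?_
  simp only [CliffordAlgebra.equivOfIsometry_apply, CliffordAlgebra.map_apply_ι]
  rw [cliffordInvolution_ι]
  exact congrArg _ (hf v).symm

theorem polarBilin_isRefl (q : QuadraticForm F V) :
    LinearMap.BilinForm.IsRefl (QuadraticMap.polarBilin q) := fun a b h =>
  (QuadraticMap.polar_comm q b a).trans h

/-- The orthogonal complement with respect to the polar form. -/
def perp (q : QuadraticForm F V) (W : Submodule F V) : Submodule F V :=
  LinearMap.BilinForm.orthogonal (QuadraticMap.polarBilin q) W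

theorem mem_perp {W : Submodule F V} {x : V} :
    x ∈ perp q W ↔ ∀ w ∈ W, QuadraticMap.polar q w x = 0 := Iff.rfl

variable {W : Submodule F V} (τ : q.IsometryEquiv q) (hτ : ∀ x, τ (τ x) = x)

include hτ in
theorem perp_stable (hW : ∀ x ∈ W, τ x ∈ W) (x : V) (hx : x ∈ perp q W) : τ x ∈ perp q W := by
  intro w hw
  change QuadraticMap.polar q w (τ x) = 0
  rw [← polar_isometry_left τ hτ]
  exact hx _ (hW w hw)

theorem isCompl_perp [FiniteDimensional F V] (hd : Disjoint W (perp q W)) :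
    IsCompl W (perp q W) :=
  (LinearMap.BilinForm.isCompl_orthogonal_iff_disjoint (polarBilin_isRefl q)).2 hd

theorem polarBilin_restrict_perp_nondegenerate
    (hq : (QuadraticMap.polarBilin q).Nondegenerate) (hc : IsCompl W (perp q W)) :
    (QuadraticMap.polarBilin (q.restrict (perp q W))).Nondegenerate := by
  have key : ∀ a : perp q W, (∀ b : perp q W, QuadraticMap.polar q (a : V) b = 0) → a = 0 := by
    intro a ha
    refine Subtype.ext (hq.1 _ fun b => ?_)
    obtain ⟨w, hw, z, hz, rfl⟩ := Submodule.mem_sup.1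
      (hc.sup_eq_top ▸ Submodule.mem_top : b ∈ W ⊔ perp q W)
    change QuadraticMap.polar q (a : V) (w + z) = 0
    rw [QuadraticMap.polar_add_right, ha ⟨z, hz⟩, QuadraticMap.polar_comm, mem_perp.1 a.2 w hw,
      add_zero]
  exact ⟨fun a ha => key a ha, fun a ha => key a fun b =>
    (QuadraticMap.polar_comm q _ _).trans (ha b)⟩

include hτ in
-- Decompose z along W ⊕ W^⊥: the W-component of w + (τz - z) must vanish because x lies in W^⊥. The
-- summand w lets the statement serve both the fixed subspace W and, with w = 0, the blocks of the
-- induction.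
theorem fixed_of_perp (hW : ∀ x ∈ W, τ x ∈ W) (hc : IsCompl W (perp q W))
    (hfix : ∀ x, τ x = x → ∃ w ∈ W, ∃ z, w + (τ z - z) = x)
    (x : perp q W) (hx : τ x = x) : ∃ z : perp q W, τ z - z = x := by
  obtain ⟨w, hw, z, hz⟩ := hfix x hx
  obtain ⟨p, hp, y, hy, rfl⟩ := Submodule.mem_sup.1
      (hc.sup_eq_top ▸ Submodule.mem_top : z ∈ W ⊔ perp q W)
  refine ⟨⟨y, hy⟩, ?_⟩
  have h1 : w + (τ p - p) ∈ W := add_mem hw (sub_mem (hW p hp) hp)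
  have h2 : (x : V) - (τ y - y) ∈ perp q W :=
    sub_mem x.2 (sub_mem (perp_stable τ hτ hW y hy) hy)
  have hadd : τ (p + y) = τ p + τ y := map_add τ.toLinearEquiv p y
  have h3 : w + (τ p - p) = x - (τ y - y) := by
    rw [← hz, hadd]
    abel
  have h4 : (x : V) - (τ y - y) = 0 := Submodule.disjoint_def.1 hc.disjoint _ (h3 ▸ h1) h2
  exact (sub_eq_zero.1 h4).symm

theorem isomorphic_tensor_perp [CharP F 2] (hW : ∀ x ∈ W, τ x ∈ W) (hc : IsCompl W (perp q W)) :
    (cliffordInvolution τ hτ).Isomorphic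
      ((cliffordInvolution (restrictIsometry τ hτ W hW)
          (restrictIsometry_involutive τ hτ W hW)).tensor
        (cliffordInvolution (restrictIsometry τ hτ (perp q W) (perp_stable τ hτ hW))
          (restrictIsometry_involutive τ hτ (perp q W) (perp_stable τ hτ hW)))) := by
  refine isomorphic_tensor τ hτ _ _ _ _ (Submodule.prodEquivOfIsCompl _ _ hc).symm ?_ ?_
  · intro a b
    rw [LinearEquiv.symm_symm, Submodule.coe_prodEquivOfIsCompl', QuadraticMap.map_add q,
      mem_perp.1 b.2 a a.2, add_zero]
    rfl
  · intro a b
    rw [LinearEquiv.symm_symm, Submodule.coe_prodEquivOfIsCompl',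
      Submodule.coe_prodEquivOfIsCompl', coe_restrictIsometry, coe_restrictIsometry]
    exact map_add τ.toLinearEquiv _ _

end

/-! ### Blocks spanned by twist frames. -/

section

variable {F V : Type*} [Field F] [AddCommGroup V] [Module F V]
  {q : QuadraticForm F V} {τ : q.IsometryEquiv q} {x v y u : V}

namespace IsTwistFrame

theorem map_frameMap (h : IsTwistFrame τ x v y u) (p : (F × F) × (F × F)) :
    q (frameMap F x v y u p) = (hyperbolicPlane F).prod (hyperbolicPlane F) p := by
  obtain ⟨⟨a, b⟩, c, d⟩ := p
  simp only [frameMap_apply, QuadraticMap.map_add q, QuadraticMap.map_smul,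
    QuadraticMap.polar_add_left, QuadraticMap.polar_add_right, QuadraticMap.polar_smul_left,
    QuadraticMap.polar_smul_right, h.polar_xv, h.polar_yu, h.polar_xy, h.polar_xu, h.polar_vy,
    h.polar_vu, h.map_x, h.map_v, h.map_y, h.map_u, QuadraticMap.prod_apply, hyperbolicPlane_apply]
  simp
  ring

variable [CharP F 2]

/-- Pairing with the dual frame vector recovers each coordinate; this yields both independence of
the frame and nondegeneracy of its span. -/
theorem polar_frameMap (h : IsTwistFrame τ x v y u) (a b c d : F) :
    QuadraticMap.polar q (frameMap F x v y u ((a, b), (c, d))) v = a ∧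
    QuadraticMap.polar q (frameMap F x v y u ((a, b), (c, d))) x = b ∧
    QuadraticMap.polar q (frameMap F x v y u ((a, b), (c, d))) u = c ∧
    QuadraticMap.polar q (frameMap F x v y u ((a, b), (c, d))) y = d := by
  simp only [frameMap_apply, QuadraticMap.polar_add_left, QuadraticMap.polar_smul_left,
    polar_self_eq_zero, h.polar_xv, h.polar_yu, h.polar_xy, h.polar_xu, h.polar_vy, h.polar_vu,
    (QuadraticMap.polar_comm q v x).trans h.polar_xv,
    (QuadraticMap.polar_comm q u y).trans h.polar_yu,
    (QuadraticMap.polar_comm q y x).trans h.polar_xy,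
    (QuadraticMap.polar_comm q u x).trans h.polar_xu,
    (QuadraticMap.polar_comm q y v).trans h.polar_vy,
    (QuadraticMap.polar_comm q u v).trans h.polar_vu]
  simp

theorem isometry_frameMap (h : IsTwistFrame τ x v y u) (p : (F × F) × (F × F)) :
    τ (frameMap F x v y u p) = frameMap F x v y u (hyperbolicTwist F p) := by
  obtain ⟨⟨a, b⟩, c, d⟩ := p
  have hadd : ∀ a b, τ (a + b) = τ a + τ b := map_add τ.toLinearEquiv
  have hsmul : ∀ (c : F) a, τ (c • a) = c • τ a := map_smul τ.toLinearEquiv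
  rw [hyperbolicTwist_apply, frameMap_apply, frameMap_apply]
  simp only [hadd, hsmul, h.isometry_x, h.isometry_v, h.isometry_y, h.isometry_u]
  module

theorem frameMap_injective (h : IsTwistFrame τ x v y u) :
    Function.Injective (frameMap F x v y u) := by
  rw [injective_iff_map_eq_zero]
  rintro ⟨⟨a, b⟩, c, d⟩ h0
  obtain ⟨h1, h2, h3, h4⟩ := h.polar_frameMap a b c d
  simp only [h0, QuadraticMap.polar_zero_left] at h1 h2 h3 h4
  simp [← h1, ← h2, ← h3, ← h4]

/-- The span of a twist frame is isometric to the sum of two hyperbolic planes. -/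
noncomputable def isometryEquiv (h : IsTwistFrame τ x v y u) :
    (q.restrict (LinearMap.range (frameMap F x v y u))).IsometryEquiv
      ((hyperbolicPlane F).prod (hyperbolicPlane F)) :=
  QuadraticMap.IsometryEquiv.symm
    ⟨LinearEquiv.ofInjective _ h.frameMap_injective, h.map_frameMap⟩

theorem range_stable (h : IsTwistFrame τ x v y u) (z : V)
    (hz : z ∈ LinearMap.range (frameMap F x v y u)) :
    τ z ∈ LinearMap.range (frameMap F x v y u) := by
  obtain ⟨p, rfl⟩ := hz
  exact ⟨_, (h.isometry_frameMap p).symm⟩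

theorem isomorphic_transpose (h : IsTwistFrame τ x v y u) (hτ : ∀ x, τ (τ x) = x) :
    (cliffordInvolution (restrictIsometry τ hτ _ h.range_stable)
      (restrictIsometry_involutive τ hτ _ h.range_stable)).Isomorphic
      (AlgInvolution.transpose F 4) := by
  refine (isomorphic_of_isometryEquiv _ _ (hyperbolicTwist F) (hyperbolicTwist_involutive F)
    h.isometryEquiv fun z => ?_).trans (hyperbolicTwist_isomorphic F)
  obtain ⟨p, rfl⟩ := h.isometryEquiv.toLinearEquiv.symm.surjective z
  have h1 : ∀ p, h.isometryEquiv (h.isometryEquiv.toLinearEquiv.symm p) = p :=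
    h.isometryEquiv.toLinearEquiv.apply_symm_apply
  have h2 : restrictIsometry τ hτ _ h.range_stable (h.isometryEquiv.toLinearEquiv.symm p) =
      h.isometryEquiv.toLinearEquiv.symm (hyperbolicTwist F p) :=
    Subtype.ext (h.isometry_frameMap p)
  rw [h2, h1, h1]

theorem disjoint_perp (h : IsTwistFrame τ x v y u) :
    Disjoint (LinearMap.range (frameMap F x v y u))
      (perp q (LinearMap.range (frameMap F x v y u))) := by
  rw [Submodule.disjoint_def]
  rintro _ ⟨⟨⟨a, b⟩, c, d⟩, rfl⟩ h0
  have hv : v ∈ LinearMap.range (frameMap F x v y u) := ⟨((0, 1), 0, 0), by simp [frameMap_apply]⟩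
  have hx : x ∈ LinearMap.range (frameMap F x v y u) := ⟨((1, 0), 0, 0), by simp [frameMap_apply]⟩
  have hu : u ∈ LinearMap.range (frameMap F x v y u) := ⟨((0, 0), 0, 1), by simp [frameMap_apply]⟩
  have hy : y ∈ LinearMap.range (frameMap F x v y u) := ⟨((0, 0), 1, 0), by simp [frameMap_apply]⟩
  obtain ⟨h1, h2, h3, h4⟩ := h.polar_frameMap a b c d
  rw [QuadraticMap.polar_comm, mem_perp.1 h0 _ ‹_›] at h1 h2 h3 h4
  rw [← h1, ← h2, ← h3, ← h4]
  exact map_zero _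

theorem finrank_range (h : IsTwistFrame τ x v y u) :
    Module.finrank F (LinearMap.range (frameMap F x v y u)) = 4 := by
  rw [LinearMap.finrank_range_of_inj h.frameMap_injective]
  simp

end IsTwistFrame

/-- Base case of the induction: the Clifford algebra of the zero space is F = M_1(F). -/
theorem isomorphic_transpose_one [Subsingleton V] (τ : q.IsometryEquiv q)
    (hτ : ∀ x, τ (τ x) = x) :
    (cliffordInvolution τ hτ).Isomorphic (AlgInvolution.transpose F 1) := by
  have hbij : Function.Bijective (Algebra.ofId F (Matrix (Fin 1) (Fin 1) F)) := by
    refine ⟨FaithfulSMul.algebraMap_injective F _, fun M => ⟨M 0 0, ?_⟩⟩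
    ext i j
    rw [Subsingleton.elim i 0, Subsingleton.elim j 0]
    simp [Algebra.ofId_apply, Matrix.algebraMap_matrix_apply]
  let e : q.IsometryEquiv (0 : QuadraticForm F Unit) :=
    ⟨LinearEquiv.ofSubsingleton V Unit, fun v => by
      rw [Subsingleton.elim v 0]
      exact (QuadraticMap.map_zero q).symm⟩
  refine isomorphic_of_ι τ hτ _ (((CliffordAlgebra.equivOfIsometry e).trans
    CliffordAlgebraRing.equiv).trans (AlgEquiv.ofBijective _ hbij)) fun v => ?_
  rw [Subsingleton.elim v 0, Subsingleton.elim (τ 0) 0]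
  simp

end

/-- If `ω_τ` is alternating and `k(τ) = r(τ)`, then the Clifford algebra with involution of `τ` is
a matrix algebra with transposition. -/
theorem isomorphic_transpose_of_fixed {F : Type*} [Field F] [CharP F 2] (n : ℕ) :
    ∀ {V : Type*} [AddCommGroup V] [Module F V] [FiniteDimensional F V] (q : QuadraticForm F V)
      (_ : (QuadraticMap.polarBilin q).Nondegenerate) (τ : q.IsometryEquiv q)
      (hτ : ∀ x, τ (τ x) = x) (_ : ∀ x, τ x = x → ∃ z, τ z - z = x)
      (_ : ∀ x, QuadraticMap.polar q (τ x) x = 0) (_ : Module.finrank F V = 2 * n),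
      (cliffordInvolution τ hτ).Isomorphic (AlgInvolution.transpose F (2 ^ n)) := by
  induction n using Nat.strong_induction_on with
  | _ n ih =>
  intro V _ _ _ q hq τ hτ hfix halt hn
  rcases subsingleton_or_nontrivial V with hV | hV
  · obtain rfl : n = 0 := by
      rw [Module.finrank_zero_of_subsingleton] at hn
      omega
    exact isomorphic_transpose_one τ hτ
  obtain ⟨x, v, y, u, h⟩ := exists_isTwistFrame hq τ hτ hfix halt
  have hc := isCompl_perp h.disjoint_perp
  have hrank := Submodule.finrank_add_eq_of_isCompl hc
  rw [h.finrank_range, hn] at hrank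
  -- A block has dimension 4, so n drops by 2; this is why the induction is strong.
  obtain ⟨m, rfl⟩ : ∃ m, n = 2 + m := ⟨n - 2, by omega⟩
  have hU := ih m (by omega) (q.restrict (perp q (LinearMap.range (frameMap F x v y u))))
    (polarBilin_restrict_perp_nondegenerate hq hc)
    (restrictIsometry τ hτ _ (perp_stable τ hτ h.range_stable))
    (restrictIsometry_involutive τ hτ _ _)
    (fun z hz => by
      obtain ⟨z', hz'⟩ := fixed_of_perp τ hτ h.range_stable hc
        (fun x hx => ⟨0, zero_mem _, by simpa using hfix x hx⟩) z (congrArg Subtype.val hz)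
      exact ⟨z', Subtype.ext hz'⟩)
    (fun z => halt z) (by omega)
  refine ((isomorphic_tensor_perp τ hτ h.range_stable hc).trans
    ((h.isomorphic_transpose hτ).tensor hU)).trans ?_
  -- The factor 2 ^ 2 is definitionally the size 4 of the block.
  rw [pow_add]
  exact AlgInvolution.transpose_tensor_transpose _ _

end QuadIsometry

/-! ### Reduction of the theorem to W and its orthogonal. -/

theorem corollary4p5 {F V : Type*} [Field F] [CharP F 2] [AddCommGroup V] [Module F V]
    [FiniteDimensional F V] (q : QuadraticForm F V)
    (hq : (QuadraticMap.polarBilin q).Nondegenerate)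
    (τ : q.IsometryEquiv q) (hτ : ∀ x, τ (τ x) = x)
    (W : Submodule F V)
    (hWdisj : W ⊓ QuadIsometry.residualSpace τ = ⊥)
    (hWsup : W ⊔ QuadIsometry.residualSpace τ = QuadIsometry.fixedSpace τ)
    (halt : (QuadIsometry.wallForm τ).IsAlt) :
    AlgInvolution.Isomorphic
      (QuadIsometry.cliffordInvolution τ hτ)
      ((QuadIsometry.cliffordInvolutionId (q.restrict W)).tensor
        (AlgInvolution.transpose F
          (2 ^ Module.finrank F (QuadIsometry.residualSpace τ)))) := by
  have hfixed : ∀ x ∈ W, τ x = x := fun x hx =>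
    (hWsup ▸ Submodule.mem_sup_left hx : x ∈ QuadIsometry.fixedSpace τ)
  have hW : ∀ x ∈ W, τ x ∈ W := fun x hx => (hfixed x hx).symm ▸ hx
  -- By self-adjointness of τ - 1 and nondegeneracy, the orthogonal of its image is its kernel.
  have hperp : QuadIsometry.perp q (QuadIsometry.residualSpace τ) =
      QuadIsometry.fixedSpace τ := by
    ext x
    have hpol : ∀ z, QuadraticMap.polar q (τ z - z) x = QuadraticMap.polar q z (τ x - x) := by
      intro z
      rw [QuadraticMap.polar_sub_left, QuadraticMap.polar_sub_right,
        QuadIsometry.polar_isometry_left τ hτ]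
    constructor
    · intro hx
      refine sub_eq_zero.1 (hq.2 _ fun z => ?_)
      exact (hpol z).symm.trans (hx _ ⟨z, rfl⟩)
    · rintro (hx : τ x = x) _ ⟨z, rfl⟩
      exact (hpol z).trans (by rw [hx, sub_self, QuadraticMap.polar_zero_right])
  have hperp' : QuadIsometry.perp q (QuadIsometry.fixedSpace τ) =
      QuadIsometry.residualSpace τ := by
    rw [← hperp]
    exact LinearMap.BilinForm.orthogonal_orthogonal hq (QuadIsometry.polarBilin_isRefl q) _
  have hc : IsCompl W (QuadIsometry.perp q W) := by
    refine QuadIsometry.isCompl_perp (Submodule.disjoint_def.2 fun x hx hx' => ?_)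
    rw [← Submodule.mem_bot F, ← hWdisj]
    refine ⟨hx, ?_⟩
    rw [SetLike.mem_coe, ← hperp', ← hWsup]
    intro z hz
    obtain ⟨w, hw, r, hr, rfl⟩ := Submodule.mem_sup.1 hz
    have h1 := QuadIsometry.mem_perp.1 hx' w hw
    have h2 : x ∈ QuadIsometry.perp q (QuadIsometry.residualSpace τ) := hperp ▸ hfixed x hx
    have h3 := QuadIsometry.mem_perp.1 h2 r hr
    exact (QuadraticMap.polar_add_left q w r x).trans (by rw [h1, h3, add_zero])
  have hfix : ∀ x, τ x = x → ∃ w ∈ W, ∃ z, w + (τ z - z) = x := by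
    intro x hx
    have hx' : x ∈ W ⊔ QuadIsometry.residualSpace τ := hWsup ▸ hx
    obtain ⟨w, hw, _, ⟨z, rfl⟩, rfl⟩ := Submodule.mem_sup.1 hx'
    exact ⟨w, hw, z, rfl⟩
  -- The Wall form at (τx - x, τx - x) is b(τx - x, x), and b(x, x) = 0 in characteristic 2.
  have halt' : ∀ x, QuadraticMap.polar q (τ x) x = 0 := by
    intro x
    have h := halt ⟨τ x - x, x, rfl⟩
    rwa [QuadIsometry.wallForm_apply, QuadraticMap.polar_sub_left,
      QuadIsometry.polar_self_eq_zero, sub_zero] at h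
  -- Combine dim k(τ) = dim W + s with dim V = dim k(τ) + s.
  have hrank : Module.finrank F (QuadIsometry.perp q W) =
      2 * Module.finrank F (QuadIsometry.residualSpace τ) := by
    have h1 := Submodule.finrank_add_eq_of_isCompl hc
    have h2 := Submodule.finrank_sup_add_finrank_inf_eq W (QuadIsometry.residualSpace τ)
    have h3 : Module.finrank F (QuadIsometry.residualSpace τ) +
        Module.finrank F (QuadIsometry.fixedSpace τ) = Module.finrank F V := by
      have hker : LinearMap.ker (QuadIsometry.subId τ) = QuadIsometry.fixedSpace τ := by
        ext x
        rw [LinearMap.mem_ker, QuadIsometry.subId_apply, sub_eq_zero]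
        rfl
      rw [← hker]
      exact LinearMap.finrank_range_add_finrank_ker _
    rw [hWsup, hWdisj, finrank_bot] at h2
    omega
  refine (QuadIsometry.isomorphic_tensor_perp τ hτ hW hc).trans
    (AlgInvolution.Isomorphic.tensor ?_ ?_)
  · exact QuadIsometry.isomorphic_of_isometryEquiv _ _ _ _ (QuadraticMap.IsometryEquiv.refl _)
      fun x => Subtype.ext (hfixed x x.2)
  · refine QuadIsometry.isomorphic_transpose_of_fixed _ _
      (QuadIsometry.polarBilin_restrict_perp_nondegenerate hq hc) _ _ (fun z hz => ?_)
      (fun z => halt' z) hrank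
    obtain ⟨z', hz'⟩ := QuadIsometry.fixed_of_perp τ hτ hW hc hfix z (congrArg Subtype.val hz)
    exact ⟨z', Subtype.ext hz'⟩
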